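/- Let $(S,A,P,R,\gamma)$ be a Markov decision process with finite state space $S$ and finite action space $A$. Executing $a$ in $s$ yields a random pair $(r,s')$ of a real reward and a next state, whose joint law depends only on $(s,a)$. Let $\pi^1,\dots,\pi^n:S\to A$ be expert policies, let $\tau_0\in\mathbb N$ and $c\in\mathbb R$. The integrated action space $\mathcal M$ consists of the primitive actions, which have duration $1$, and of the macro actions $m^i(\tau)$ for $1\le i\le n$ and $1\le\tau\le\tau_0$, where $m^i(\tau)$ executes $\pi^i$ for $\tau$ time steps. Write $a_m(s)$ for the lower-level action that $m\in\mathcal M$ executes in $s$ (so $a_m(s)=a$ for a primitive action $m=a$, and $a_m(s)=\pi^i(s)$ for $m=m^i(\tau)$), and $\tau(m)$ for the duration of $m$. Executing one time step of an action with $\tau$ time steps to go earns, besides the reward $r$, the macro action bonus $c(\tau-1)$ ($c=0$ means no bonus). For a policy $\pi(m\mid s)$ on $\mathcal M$, let $Q^\pi(s,m)$ be the expected $\gamma$-discounted sum $\sum_{k\ge0}\gamma^k\,\mathbb E[\rho_k]$ of the one-step rewards $\rho_k$ (bonus included) when $m$ is started in $s$ and, each time an action has ended, the next one is drawn from $\pi(\cdot\mid\text{current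 state})$. Let $Q^*(s,m)=\sup_\pi Q^\pi(s,m)$ be the optimal action-value function. Consider on a probability space with a filtration $(\mathcal F_t)_{t\ge 0}$ tabular iterates $Q_t:S\times\mathcal M\to\mathbb R$ with arbitrary $\mathcal F_0$-measurable $Q_0$ and $$Q_{t+1}(s,m)=(1-\alpha_t(s,m))\,Q_t(s,m)+\alpha_t(s,m)\,y_t(s,m),$$ $$y_t(s,m)=\begin{cases} r+c(\tau(m)-1)+\gamma\max_{m'\in\mathcal M}Q_t(s',m'), & \tau(m)=1,\\ r+c(\tau(m)-1)+\gamma\,Q_t(s',m^i(\tau-1)), & m=m^i(\tau),\ \tau>1,\end{cases}$$ where the learning rates $\alpha_t(s,m)\ge0$ are $\mathcal F_t$-measurable (and are $0$ when the entry is not updated), and the observation $(r,s')=(r_t(s,m),s'_t(s,m))$ is $\mathcal F_{t+1}$-measurable and, on the event $\alpha_t(s,m)\neq0$, has conditionally on $\mathcal F_t$ the law that the decision process prescribes for $(s,a_m(s))$. The observations used for different entries need not be independent; they may be one shared transition. Assume that 1. $S$ and $A$ are finite; 2. with probability $1$, $\sum_t\alpha_t(s,m)=\infty$ and $\sum_t\alpha_t(s,m)^2<\infty$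 for all $(s,m)\in S\times\mathcal M$; 3. the variance of the reward $r$ is bounded, uniformly over $(s,a)\in S\times A$; 4. $\gamma\in(0,1)$. Then the supremum defining $Q^*(s,m)$ is a maximum for every $(s,m)$, and with probability $1$, $Q_t(s,m)\to Q^*(s,m)$ as $t\to\infty$ for all $(s,m)\in S\times\mathcal M$. -/

import Mathlib

open MeasureTheory ProbabilityTheory Filter Topology
open scoped NNReal

namespace EASpace

/-- A Markov decision process with state space `S`, action space `A` and random real rewards.
`step s a` is the joint law of the pair (immediate reward, next state) when the action `a` is
executed in the state `s`. -/
structure MDP (S A : Type*) [MeasurableSpace S] where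
  step : S → A → Measure (ℝ × S)
  isProb : ∀ s a, IsProbabilityMeasure (step s a)

/-- The integrated action space: a primitive action `Sum.inl a`, or the macro action
`Sum.inr (i, k)`, which follows the expert policy `i` for `k + 1` time steps, where
`1 ≤ k + 1 ≤ τ₀`. -/
abbrev IntAction (A : Type*) (n τ₀ : ℕ) : Type _ := A ⊕ (Fin n × Fin τ₀)

section Actions

variable {S A : Type*} {n τ₀ : ℕ}

/-- The duration of an integrated action (primitive actions last one time step). -/
def duration : IntAction A n τ₀ → ℕ
  | Sum.inl _ => 1
  | Sum.inr (_, k) => (k : ℕ) + 1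

/-- What is left of an integrated action after one time step: `none` if its duration is `1`, and
the macro action of the same expert with duration `τ - 1` if its duration is `τ > 1`. -/
def rest : IntAction A n τ₀ → Option (IntAction A n τ₀)
  | Sum.inl _ => none
  | Sum.inr (_, ⟨0, _⟩) => none
  | Sum.inr (i, ⟨k + 1, h⟩) => some (Sum.inr (i, ⟨k, Nat.lt_of_succ_lt h⟩))

/-- The lower-level action that an integrated action executes in the state `s`; `expert i` is the
`i`-th (deterministic, Markov) expert policy. -/
def lower (expert : Fin n → S → A) : IntAction A n τ₀ → S → A
  | Sum.inl a, _ => a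
  | Sum.inr (i, _), s => expert i s

end Actions

noncomputable section

variable {S A : Type*} [Fintype S] [Fintype A] [MeasurableSpace S] {n τ₀ : ℕ}

/-- The transition probability `P(s' | s, a)`. -/
def MDP.trans (M : MDP S A) (s : S) (a : A) (s' : S) : ℝ :=
  (M.step s a).real (Prod.snd ⁻¹' {s'})

/-- The mean of the immediate reward for the action `a` in the state `s`. -/
def MDP.meanReward (M : MDP S A) (s : S) (a : A) : ℝ :=
  ∫ x, x.1 ∂(M.step s a)

/-- The expected one-step reward, including the macro action bonus `c * (duration - 1)`, when `m`
is being executed in `s` with `duration m` time steps to go. -/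
def stepReward (M : MDP S A) (expert : Fin n → S → A) (c : ℝ) (s : S) (m : IntAction A n τ₀) : ℝ :=
  M.meanReward s (lower expert m s) + c * ((duration m : ℝ) - 1)

/-- A policy over the integrated action space: `(π s).1 m` is the probability of choosing `m`
when the previous action has ended in the state `s`. -/
abbrev Policy (S A : Type*) [Fintype A] (n τ₀ : ℕ) : Type _ :=
  S → stdSimplex ℝ (IntAction A n τ₀)

/-- The one-step expectation operator of the Markov chain (state, action in progress) under the
policy `π`: the lower-level action is executed, the state moves to `s'`, and then a macro action
that has not ended goes on with one time step less, while after the end of an action a new one is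
drawn from `π s'`. -/
def expectNext (M : MDP S A) (expert : Fin n → S → A) (π : Policy S A n τ₀)
    (f : S → IntAction A n τ₀ → ℝ) (s : S) (m : IntAction A n τ₀) : ℝ :=
  ∑ s', M.trans s (lower expert m s) s' *
    (match rest m with
      | none => ∑ m', (π s').1 m' * f s' m'
      | some m' => f s' m')

/-- The action value `Q^π(s, m)`: the expected discounted sum of rewards `∑ₖ γᵏ E[rₖ]` when `m` is
started in `s` and `π` is followed afterwards. The `k`-th iterate of `expectNext`, applied to
`stepReward`, is the expected reward at time `k`. -/
def policyValue (M : MDP S A) (expert : Fin n → S → A) (c γ : ℝ) (π : Policy S A n τ₀)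
    (s : S) (m : IntAction A n τ₀) : ℝ :=
  ∑' k : ℕ, γ ^ k * ((expectNext M expert π)^[k] (stepReward M expert c)) s m

/-- The optimal action value function `Q*(s, m)`, the best value over all policies. -/
def optimalValue (M : MDP S A) (expert : Fin n → S → A) (c γ : ℝ)
    (s : S) (m : IntAction A n τ₀) : ℝ :=
  ⨆ π : Policy S A n τ₀, policyValue M expert c γ π s m

/-- The temporal-difference target for `m` from the table `q`, the total reward `r` and the next
state `s'`. The supremum is a maximum over the finite integrated action space. -/
def tdTarget (γ : ℝ) (q : S → IntAction A n τ₀ → ℝ) (m : IntAction A n τ₀) (r : ℝ) (s' : S) : ℝ :=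
  r + γ * (match rest m with
    | none => ⨆ m', q s' m'
    | some m' => q s' m')

/-- A run of the tabular learning rule on a probability space with a filtration `ℱ` (the past).
`Q t` is the table, `α t s m` the learning rate used for the entry `(s, m)` at step `t` (zero if
that entry is not updated), and `X t s m` the observed (reward, next state) used in this update.
Initial table and learning rates may be random, but may depend on the past only. Whenever the entry
is updated, the observation has, conditionally on the past, the law that the decision process
prescribes for the lower-level action of `m` in `s`. No relation between the observations for
different entries is imposed, so that several entries may share one transition. -/
structure IsRun (M : MDP S A) (expert : Fin n → S → A) (c γ : ℝ)
    {Ω : Type*} [mΩ : MeasurableSpace Ω] (μ : Measure Ω) (ℱ : Filtration ℕ mΩ)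
    (α : ℕ → S → IntAction A n τ₀ → Ω → ℝ)
    (X : ℕ → S → IntAction A n τ₀ → Ω → ℝ × S)
    (Q : ℕ → S → IntAction A n τ₀ → Ω → ℝ) : Prop where
  init_meas : ∀ s m, Measurable[ℱ 0] (Q 0 s m)
  rate_meas : ∀ t s m, Measurable[ℱ t] (α t s m)
  rate_nonneg : ∀ t s m ω, 0 ≤ α t s m ω
  obs_meas : ∀ t s m, Measurable[ℱ (t + 1)] (X t s m)
  obs_law : ∀ t s m (E : Set Ω), MeasurableSet[ℱ t] E → (∀ ω ∈ E, α t s m ω ≠ 0) →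
    ∀ B : Set (ℝ × S), MeasurableSet B →
      μ (E ∩ X t s m ⁻¹' B) = μ E * M.step s (lower expert m s) B
  update : ∀ t s m ω, Q (t + 1) s m ω = (1 - α t s m ω) * Q t s m ω +
    α t s m ω * tdTarget γ (fun s₁ m₁ => Q t s₁ m₁ ω) m
      ((X t s m ω).1 + c * ((duration m : ℝ) - 1)) (X t s m ω).2

end

end EASpace

/-!
Write `next q m s'` for the value that a table `q` gives to the next state `s'` after one step of
the action `m` (`nextValue`): the maximum over all actions if `m` has ended, and the entry of the
rest of `m` otherwise. The temporal-difference target is the reward plus `γ * next q m s'`. The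
optimality operator, its mean, is a `γ`-contraction in the sup norm. Its fixed point `q` dominates
the value of every policy, and the greedy policy attains it, because along
a policy with expectation operator `E` the discounted sum of `q - γ E q` telescopes to `q` (`isGreatest_policyValue`). So `q` is the
optimal action value, and the supremum is a maximum.

For the convergence, the point is that `next` is nonexpansive for every single realization of
`s'`, and not only in the mean (`abs_nextValue_sub_le`). The target built from `Q_t` therefore
differs from the one built from `q`, with the same observation, by at most `γ * ‖Q_t - q‖`. What
remains is the noise `g(r, s')`, the target built from `q` minus `q` itself
(`targetNoise`). It does not involve `Q_t`, has mean zero by the Bellman equation and a finite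
second moment. Hence no bound on the tables `Q_t` is needed beforehand, and nothing about their
integrability: the accumulated noise `∑ α_t g(X_t)` is a martingale, bounded in `L²` once the
weights are stopped when the sum of their squares exceeds a level, so it converges almost surely
(`ae_exists_tendsto_weighted_noise`).

The rest is pathwise. The deviation `Q_t - q`, corrected by the noise still to come, is averaged
with the weights `α_t` towards values of size at most `γ` times its own sup norm plus a vanishing
error. As each entry is updated with infinite total weight, this forces it to `0`
(`tendsto_zero_of_contracting_averaging`).
-/

namespace EASpace

/-! ### Deterministic averaging recursions -/

/-- A sequence that is averaged towards values at most `B`, with weights of infinite sum, is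
eventually at most `B + δ`: the excess over `B` shrinks at least by the factor
`1 - a ≤ exp (-a)`. -/
theorem eventually_le_of_averaging {a d : ℕ → ℝ} {B : ℝ}
    (ha1 : ∀ᶠ t in atTop, a t ≤ 1)
    (ha : Tendsto (fun T => ∑ t ∈ Finset.range T, a t) atTop atTop)
    (hd : ∀ᶠ t in atTop, d (t + 1) ≤ (1 - a t) * d t + a t * B) {δ : ℝ} (hδ : 0 < δ) :
    ∀ᶠ t in atTop, d t ≤ B + δ := by
  obtain ⟨t₀, ht₀⟩ := eventually_atTop.1 (ha1.and hd)
  set P : ℕ → ℝ := fun T => ∑ t ∈ Finset.range T, a t with hP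
  set u : ℕ → ℝ := fun t => max (d t - B) 0 * Real.exp (P t) with hu
  have hstep : ∀ t ≥ t₀, u (t + 1) ≤ u t := by
    intro t ht
    obtain ⟨h1, h2⟩ := ht₀ t ht
    have hmax : max (d (t + 1) - B) 0 ≤ (1 - a t) * max (d t - B) 0 := by
      have h3 : d t - B ≤ max (d t - B) 0 := le_max_left _ _
      have h4 : 0 ≤ max (d t - B) 0 := le_max_right _ _
      refine max_le ?_ (mul_nonneg (by linarith) h4)
      have := mul_le_mul_of_nonneg_left h3 (by linarith : 0 ≤ 1 - a t)
      linarith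
    have hexp : (1 - a t) * Real.exp (a t) ≤ 1 := by
      have h5 := Real.add_one_le_exp (-a t)
      calc (1 - a t) * Real.exp (a t) ≤ Real.exp (-a t) * Real.exp (a t) := by
            gcongr; linarith
        _ = 1 := by rw [← Real.exp_add]; simp
    have hPs : P (t + 1) = P t + a t := Finset.sum_range_succ _ _
    calc u (t + 1) ≤ ((1 - a t) * max (d t - B) 0) * Real.exp (P (t + 1)) := by
          simp only [hu]; gcongr
      _ = ((1 - a t) * Real.exp (a t)) * u t := by rw [hPs, Real.exp_add]; simp only [hu]; ring
      _ ≤ 1 * u t := by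
          gcongr
      _ = u t := one_mul _
  have hle : ∀ t ≥ t₀, u t ≤ u t₀ := by
    intro t ht
    induction t, ht using Nat.le_induction with
    | base => exact le_rfl
    | succ t ht ih => exact (hstep t ht).trans ih
  have hlim : Tendsto (fun t => u t₀ * Real.exp (-P t)) atTop (𝓝 0) := by
    simpa using (Real.tendsto_exp_neg_atTop_nhds_zero.comp ha).const_mul (u t₀)
  filter_upwards [eventually_ge_atTop t₀, hlim.eventually (ge_mem_nhds hδ)] with t ht h
  have h6 : max (d t - B) 0 = u t * Real.exp (-P t) := by
    simp only [hu]; rw [mul_assoc, ← Real.exp_add]; simp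
  have h7 : u t * Real.exp (-P t) ≤ u t₀ * Real.exp (-P t) := by
    gcongr; exact hle t ht
  have h8 := le_max_left (d t - B) 0
  linarith

/-- Asynchronous averaging towards values that are contracted by `γ < 1` in the sup norm, up to a
vanishing error, converges to `0`. -/
theorem tendsto_zero_of_contracting_averaging {ι : Type*} [Fintype ι] {D a e : ℕ → ι → ℝ}
    {ε : ℕ → ℝ} {γ : ℝ} (hγ0 : 0 ≤ γ) (hγ1 : γ < 1)
    (ha0 : ∀ t x, 0 ≤ a t x) (ha1 : ∀ x, ∀ᶠ t in atTop, a t x ≤ 1)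
    (ha : ∀ x, Tendsto (fun T => ∑ t ∈ Finset.range T, a t x) atTop atTop)
    (hD : ∀ t x, D (t + 1) x = (1 - a t x) * D t x + a t x * e t x)
    (he : ∀ t x, |e t x| ≤ γ * ‖D t‖ + ε t) (hε : Tendsto ε atTop (𝓝 0)) :
    Tendsto D atTop (𝓝 0) := by
  have hstep : ∀ t x, a t x ≤ 1 →
      |D (t + 1) x| ≤ (1 - a t x) * |D t x| + a t x * (γ * ‖D t‖ + ε t) := by
    intro t x h
    rw [hD]
    refine (abs_add_le _ _).trans ?_
    rw [abs_mul, abs_mul, abs_of_nonneg (ha0 t x), abs_of_nonneg (by linarith : 0 ≤ 1 - a t x)]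
    have := mul_le_mul_of_nonneg_left (he t x) (ha0 t x)
    linarith
  have hcomp : ∀ t x, |D t x| ≤ ‖D t‖ := fun t x => norm_le_pi_norm (D t) x
  set s : Set ℝ := {K | 0 ≤ K ∧ ∀ᶠ t in atTop, ‖D t‖ ≤ K} with hs
  have hne : s.Nonempty := by
    obtain ⟨t₀, ht₀⟩ := eventually_atTop.1
      ((eventually_all.2 ha1).and (hε.eventually (ge_mem_nhds one_pos)))
    -- this radius `K` satisfies `γ * K + 1 ≤ K`, so the ball of radius `K` is invariant
    set K := max ‖D t₀‖ (1 / (1 - γ)) with hK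
    have hK0 : 0 ≤ K := (norm_nonneg _).trans (le_max_left _ _)
    have hKγ : γ * K + 1 ≤ K := by
      have h1 : 1 / (1 - γ) ≤ K := le_max_right _ _
      rw [div_le_iff₀ (by linarith)] at h1
      linarith
    refine ⟨K, hK0, eventually_atTop.2 ⟨t₀, fun t ht => ?_⟩⟩
    induction t, ht using Nat.le_induction with
    | base => exact le_max_left _ _
    | succ t ht ih =>
      obtain ⟨h1, h2⟩ := ht₀ t ht
      refine (pi_norm_le_iff_of_nonneg hK0).2 fun x => ?_
      rw [Real.norm_eq_abs]
      have h3 := mul_le_mul_of_nonneg_left ((hcomp t x).trans ih)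
        (by linarith [h1 x] : 0 ≤ 1 - a t x)
      have h4 : γ * ‖D t‖ + ε t ≤ K := by
        have := mul_le_mul_of_nonneg_left ih hγ0
        linarith
      have h5 := mul_le_mul_of_nonneg_left h4 (ha0 t x)
      have := hstep t x (h1 x)
      linarith
  have hbdd : BddBelow s := ⟨0, fun K hK => hK.1⟩
  have himp : ∀ K ∈ s, ∀ δ > 0, γ * K + δ + δ ∈ s := by
    rintro K ⟨hK0, hK⟩ δ hδ
    have h0 : 0 ≤ γ * K + δ + δ := by positivity
    refine ⟨h0, ?_⟩
    have hx : ∀ x, ∀ᶠ t in atTop, |D t x| ≤ γ * K + δ + δ := by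
      intro x
      refine eventually_le_of_averaging (ha1 x) (ha x) ?_ hδ
      filter_upwards [ha1 x, hK, hε.eventually (ge_mem_nhds hδ)] with t h1 h2 h3
      refine (hstep t x h1).trans ?_
      have := mul_le_mul_of_nonneg_left h2 hγ0
      have := mul_le_mul_of_nonneg_left (by linarith : γ * ‖D t‖ + ε t ≤ γ * K + δ) (ha0 t x)
      linarith
    filter_upwards [eventually_all.2 hx] with t ht
    exact (pi_norm_le_iff_of_nonneg h0).2 ht
  have hinf : sInf s ≤ 0 := by
    by_contra! h
    have hδ : 0 < (1 - γ) * sInf s / 4 := by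
      have : 0 < 1 - γ := by linarith
      positivity
    obtain ⟨K, hK, hKlt⟩ := Real.lt_sInf_add_pos hne hδ
    have h1 := csInf_le hbdd (himp K hK _ hδ)
    have h2 : γ * K ≤ K - (1 - γ) * sInf s := by
      have := mul_le_mul_of_nonneg_left (csInf_le hbdd hK) (by linarith : 0 ≤ 1 - γ)
      linarith
    linarith
  rw [tendsto_zero_iff_norm_tendsto_zero]
  refine tendsto_order.2 ⟨fun b hb => Eventually.of_forall fun t => hb.trans_le (norm_nonneg _),
    fun b hb => ?_⟩
  obtain ⟨K, hK, hKlt⟩ := Real.lt_sInf_add_pos hne hb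
  filter_upwards [hK.2] with t ht
  linarith

/-! ### Almost sure convergence of weighted noise -/

/-- If `X` has the law `ν` conditionally on `m` on an event containing the support of the
`m`-measurable function `h`, then `(h, X)` has a product law on this support, whence
`E[h * g(X)] = E[h] * ν[g]`. Nothing is known about `X` where `h` vanishes. -/
theorem integral_mul_comp_of_condLaw {Ω 𝓧 : Type*} {m mΩ : MeasurableSpace Ω}
    [MeasurableSpace 𝓧] {μ : Measure Ω} [IsProbabilityMeasure μ] {ν : Measure 𝓧}
    [IsProbabilityMeasure ν] (hm : m ≤ mΩ) {X : Ω → 𝓧}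
    (hX : Measurable X) {h : Ω → ℝ} (hh : Measurable[m] h)
    (hlaw : ∀ E, MeasurableSet[m] E → (∀ ω ∈ E, h ω ≠ 0) → ∀ B, MeasurableSet B →
      μ (E ∩ X ⁻¹' B) = μ E * ν B)
    {g : 𝓧 → ℝ} (hg : Measurable g) :
    ∫ ω, h ω * g (X ω) ∂μ = (∫ ω, h ω ∂μ) * ∫ x, g x ∂ν ∧
      (Integrable h μ → Integrable g ν → Integrable (fun ω => h ω * g (X ω)) μ) := by
  set A : Set Ω := {ω | h ω ≠ 0} with hA
  have hAm : MeasurableSet[m] A := hh (measurableSet_singleton 0).compl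
  have hhm : Measurable h := hh.mono hm le_rfl
  have hprod : ((μ.restrict A).map h).prod ν = (μ.restrict A).map (fun ω => (h ω, X ω)) := by
    have : IsFiniteMeasure ((μ.restrict A).map h) := Measure.isFiniteMeasure_map _ _
    refine Measure.prod_eq fun s t hs ht => ?_
    rw [Measure.map_apply (hhm.prodMk hX) (hs.prod ht), Measure.map_apply hhm hs,
      Measure.restrict_apply (hhm.prodMk hX (hs.prod ht)), Measure.restrict_apply (hhm hs),
      ← hlaw (h ⁻¹' s ∩ A) ((hh hs).inter hAm) (fun ω hω => hω.2) t ht]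
    congr 1
    ext ω
    simp only [Set.mem_inter_iff, Set.mem_preimage, Set.mem_prod]
    tauto
  have hF : Measurable (fun p : ℝ × 𝓧 => p.1 * g p.2) :=
    measurable_fst.mul (hg.comp measurable_snd)
  have hoff : ∀ ω ∉ A, h ω = 0 := fun ω hω => by simpa [hA] using hω
  constructor
  · calc ∫ ω, h ω * g (X ω) ∂μ = ∫ ω in A, h ω * g (X ω) ∂μ :=
          (setIntegral_eq_integral_of_forall_compl_eq_zero
            fun ω hω => by rw [hoff ω hω, zero_mul]).symm
      _ = ∫ p, p.1 * g p.2 ∂((μ.restrict A).map h).prod ν := by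
          rw [hprod, integral_map (hhm.prodMk hX).aemeasurable hF.aestronglyMeasurable]
      _ = (∫ ω in A, h ω ∂μ) * ∫ x, g x ∂ν := by
          rw [integral_prod_mul (fun x : ℝ => x) g, integral_map (f := fun x : ℝ => x)
            hhm.aemeasurable measurable_id.aestronglyMeasurable]
      _ = (∫ ω, h ω ∂μ) * ∫ x, g x ∂ν := by
          rw [setIntegral_eq_integral_of_forall_compl_eq_zero hoff]
  · intro hi hgi
    have h1 : Integrable (fun x : ℝ => x) ((μ.restrict A).map h) :=
      (integrable_map_measure measurable_id.aestronglyMeasurable hhm.aemeasurable).2 hi.restrict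
    have h2 := h1.mul_prod hgi
    rw [hprod, integrable_map_measure hF.aestronglyMeasurable (hhm.prodMk hX).aemeasurable] at h2
    refine (integrableOn_iff_integrable_of_support_subset fun ω hω => ?_).1 h2
    by_contra hcon
    exact hω (by simp [hoff ω hcon])

section Noise

variable {Ω 𝓧 : Type*} [mΩ : MeasurableSpace Ω] [MeasurableSpace 𝓧]
  {μ : Measure Ω} [IsProbabilityMeasure μ] {ν : Measure 𝓧} [IsProbabilityMeasure ν]
  {ℱ : Filtration ℕ mΩ} {a : ℕ → Ω → ℝ} {X : ℕ → Ω → 𝓧} {g : 𝓧 → ℝ}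

/-- If the squared weights have a bounded sum, the weighted noise is an `L²`-bounded martingale,
hence converges almost surely. -/
theorem ae_exists_tendsto_weighted_noise_of_le
    (ha : ∀ t, Measurable[ℱ t] (a t)) (hX : ∀ t, Measurable[ℱ (t + 1)] (X t))
    (hlaw : ∀ t E, MeasurableSet[ℱ t] E → (∀ ω ∈ E, a t ω ≠ 0) → ∀ B, MeasurableSet B →
      μ (E ∩ X t ⁻¹' B) = μ E * ν B)
    (hg : Measurable g) (hg2 : MemLp g 2 ν) (hg0 : ∫ x, g x ∂ν = 0)
    {N : ℝ} (hN : ∀ T ω, ∑ t ∈ Finset.range T, a t ω ^ 2 ≤ N) :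
    ∀ᵐ ω ∂μ, ∃ l, Tendsto (fun T => ∑ t ∈ Finset.range T, a t ω * g (X t ω)) atTop (𝓝 l) := by
  set Z : ℕ → Ω → ℝ := fun T ω => ∑ t ∈ Finset.range T, a t ω * g (X t ω) with hZ
  have hZs : ∀ T ω, Z (T + 1) ω = Z T ω + a T ω * g (X T ω) :=
    fun T ω => Finset.sum_range_succ _ _
  have ham : ∀ t, Measurable (a t) := fun t => (ha t).mono (ℱ.le t) le_rfl
  have hXm : ∀ t, Measurable (X t) := fun t => (hX t).mono (ℱ.le _) le_rfl
  have hZm : ∀ T, Measurable[ℱ T] (Z T) := by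
    intro T
    refine Finset.measurable_fun_sum _ fun t ht => ?_
    have ht' : t + 1 ≤ T := Finset.mem_range.1 ht
    exact ((ha t).mono (ℱ.mono (by omega)) le_rfl).mul
      (hg.comp ((hX t).mono (ℱ.mono ht') le_rfl))
  have hasq : ∀ t ω, a t ω ^ 2 ≤ N := fun t ω =>
    (Finset.single_le_sum (f := fun t => a t ω ^ 2) (fun _ _ => sq_nonneg _)
      (Finset.self_mem_range_succ t)).trans (hN (t + 1) ω)
  have ha_bdd : ∀ t, ∀ᵐ ω ∂μ, ‖a t ω‖ ≤ √N := fun t =>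
    Eventually.of_forall fun ω => Real.abs_le_sqrt (hasq t ω)
  have ha2i : ∀ t, Integrable (fun ω => a t ω ^ 2) μ := fun t =>
    Integrable.of_bound ((ham t).pow_const 2).aestronglyMeasurable N
      (Eventually.of_forall fun ω => by
        rw [Real.norm_eq_abs, abs_of_nonneg (sq_nonneg _)]; exact hasq t ω)
  have hg2i : Integrable (fun x => g x ^ 2) ν :=
    (memLp_two_iff_integrable_sq hg.aestronglyMeasurable).1 hg2
  have hlaw' : ∀ t (h : Ω → ℝ), (∀ ω, a t ω = 0 → h ω = 0) → ∀ E, MeasurableSet[ℱ t] E →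
      (∀ ω ∈ E, h ω ≠ 0) → ∀ B, MeasurableSet B → μ (E ∩ X t ⁻¹' B) = μ E * ν B :=
    fun t h hh E hE hEh => hlaw t E hE fun ω hω h0 => hEh ω hω (hh ω h0)
  have hinc2 := fun t => integral_mul_comp_of_condLaw (μ := μ) (ν := ν) (ℱ.le t) (hXm t)
    ((ha t).pow_const 2) (hlaw' t _ fun ω h0 => by simp [h0]) (hg.pow_const 2)
  have hinc : ∀ t, MemLp (fun ω => a t ω * g (X t ω)) 2 μ := by
    intro t
    refine (memLp_two_iff_integrable_sq
      ((ham t).mul (hg.comp (hXm t))).aestronglyMeasurable).2 ?_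
    exact ((hinc2 t).2 (ha2i t) hg2i).congr (Eventually.of_forall fun ω => (mul_pow _ _ 2).symm)
  have hZ2 : ∀ T, MemLp (Z T) 2 μ := fun T => memLp_finsetSum _ fun t _ => hinc t
  have hmart : Martingale Z ℱ μ := by
    refine martingale_of_setIntegral_eq_succ (fun T => (hZm T).stronglyMeasurable)
      (fun T => (hZ2 T).integrable one_le_two) fun T s hs => ?_
    have hind : ∫ ω in s, a T ω * g (X T ω) ∂μ = 0 := by
      rw [← integral_indicator (ℱ.le T s hs)]
      have h1 := (integral_mul_comp_of_condLaw (μ := μ) (ν := ν) (ℱ.le T) (hXm T)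
        ((ha T).indicator hs)
        (hlaw' T _ fun ω h0 => by by_cases hω : ω ∈ s <;> simp [hω, h0]) hg).1
      rw [hg0, mul_zero] at h1
      rw [← h1]
      refine integral_congr_ae (Eventually.of_forall fun ω => ?_)
      by_cases hω : ω ∈ s <;> simp [hω]
    simp only [hZs]
    rw [integral_add ((hZ2 T).integrable one_le_two).restrict
      ((hinc T).integrable one_le_two).restrict, hind, add_zero]
  -- increments at different times are orthogonal, so the second moments add up
  have hsecond : ∀ T, ∫ ω, Z T ω ^ 2 ∂μ =
      (∫ ω, ∑ t ∈ Finset.range T, a t ω ^ 2 ∂μ) * ∫ x, g x ^ 2 ∂ν := by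
    intro T
    induction T with
    | zero => simp [hZ]
    | succ T ih =>
      have hZa : Integrable (fun ω => Z T ω * a T ω) μ :=
        ((hZ2 T).integrable one_le_two).mul_bdd (c := √N) (ham T).aestronglyMeasurable (ha_bdd T)
      have hcross := integral_mul_comp_of_condLaw (μ := μ) (ν := ν)
        (h := fun ω => Z T ω * a T ω) (ℱ.le T) (hXm T) ((hZm T).mul (ha T)) (hlaw' T _ fun ω h0 => by simp [h0]) hg
      have hci := (hcross.2 hZa (hg2.integrable one_le_two)).const_mul 2
      have hc0 := hcross.1
      rw [hg0, mul_zero] at hc0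
      have hexp : ∀ ω, Z (T + 1) ω ^ 2 = Z T ω ^ 2 + 2 * (Z T ω * a T ω * g (X T ω)) +
          a T ω ^ 2 * g (X T ω) ^ 2 := fun ω => by rw [hZs]; ring
      have hZ2i := (hZ2 T).integrable_sq
      have hsi : Integrable (fun ω => Z T ω ^ 2 + 2 * (Z T ω * a T ω * g (X T ω))) μ :=
        hZ2i.add hci
      simp only [hexp, Finset.sum_range_succ]
      rw [integral_add hsi ((hinc2 T).2 (ha2i T) hg2i), integral_add hZ2i hci,
        integral_const_mul, integral_add (integrable_finsetSum _ fun t _ => ha2i t) (ha2i T),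
        (hinc2 T).1, ih, hc0]
      ring
  -- `E|Z| ≤ 1 + E[Z²]` turns the bound on second moments into the one on first moments
  refine hmart.submartingale.exists_ae_tendsto_of_bdd
    (R := (1 + N * ∫ x, g x ^ 2 ∂ν).toNNReal) fun T => ?_
  have hZi := (hZ2 T).integrable one_le_two
  rw [eLpNorm_one_eq_lintegral_enorm, ← ofReal_integral_norm_eq_lintegral_enorm hZi]
  refine ENNReal.ofReal_le_ofReal ?_
  have hsum : ∫ ω, ∑ t ∈ Finset.range T, a t ω ^ 2 ∂μ ≤ N := by
    refine (integral_mono (integrable_finsetSum _ fun t _ => ha2i t) (integrable_const N)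
      (hN T)).trans ?_
    simp
  calc ∫ ω, ‖Z T ω‖ ∂μ ≤ ∫ ω, (1 + Z T ω ^ 2) ∂μ := by
        refine integral_mono hZi.norm ((integrable_const 1).add (hZ2 T).integrable_sq) fun ω => ?_
        have h1 : ‖Z T ω‖ ^ 2 = Z T ω ^ 2 := sq_abs _
        change ‖Z T ω‖ ≤ 1 + Z T ω ^ 2
        nlinarith [sq_nonneg (‖Z T ω‖ - 1), norm_nonneg (Z T ω)]
    _ = 1 + (∫ ω, ∑ t ∈ Finset.range T, a t ω ^ 2 ∂μ) * ∫ x, g x ^ 2 ∂ν := by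
        rw [integral_add (integrable_const 1) (hZ2 T).integrable_sq, hsecond]; simp
    _ ≤ 1 + N * ∫ x, g x ^ 2 ∂ν := by
        gcongr

/-- Weighted noise with almost surely square-summable weights converges almost surely. The weights
are stopped when the sum of their squares exceeds a level `N`, and `N` runs over `ℕ`. -/
theorem ae_exists_tendsto_weighted_noise
    (ha : ∀ t, Measurable[ℱ t] (a t)) (hX : ∀ t, Measurable[ℱ (t + 1)] (X t))
    (hlaw : ∀ t E, MeasurableSet[ℱ t] E → (∀ ω ∈ E, a t ω ≠ 0) → ∀ B, MeasurableSet B →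
      μ (E ∩ X t ⁻¹' B) = μ E * ν B)
    (hg : Measurable g) (hg2 : MemLp g 2 ν) (hg0 : ∫ x, g x ∂ν = 0)
    (hsq : ∀ᵐ ω ∂μ, Summable fun t => a t ω ^ 2) :
    ∀ᵐ ω ∂μ, ∃ l, Tendsto (fun T => ∑ t ∈ Finset.range T, a t ω * g (X t ω)) atTop (𝓝 l) := by
  classical
  set b : ℕ → ℕ → Ω → ℝ := fun N t ω =>
    if ∑ u ∈ Finset.range (t + 1), a u ω ^ 2 ≤ N then a t ω else 0 with hb
  have hconv : ∀ N : ℕ, ∀ᵐ ω ∂μ, ∃ l,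
      Tendsto (fun T => ∑ t ∈ Finset.range T, b N t ω * g (X t ω)) atTop (𝓝 l) := by
    intro N
    refine ae_exists_tendsto_weighted_noise_of_le (ν := ν) (N := N) (fun t => ?_) hX
      (fun t E hE hEb => hlaw t E hE fun ω hω h0 => hEb ω hω (by simp [hb, h0])) hg hg2 hg0
      fun T ω => ?_
    · refine Measurable.ite (measurableSet_le ?_ measurable_const) (ha t) measurable_const
      exact Finset.measurable_fun_sum _ fun u hu =>
        ((ha u).mono (ℱ.mono (Nat.lt_succ_iff.1 (Finset.mem_range.1 hu))) le_rfl).pow_const 2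
    · induction T with
      | zero => simp
      | succ T ih =>
        by_cases h : ∑ u ∈ Finset.range (T + 1), a u ω ^ 2 ≤ N
        · refine (Finset.sum_le_sum fun t _ => ?_).trans h
          simp only [hb]
          split_ifs
          · exact le_rfl
          · simpa using sq_nonneg (a t ω)
        · -- the weight at time `T` has been stopped, so the last term vanishes
          rw [Finset.sum_range_succ]
          simpa [hb, h] using ih
  filter_upwards [ae_all_iff.2 hconv, hsq] with ω hω hs
  obtain ⟨N, hN⟩ := exists_nat_ge (∑' t, a t ω ^ 2)
  obtain ⟨l, hl⟩ := hω N
  refine ⟨l, hl.congr fun T => Finset.sum_congr rfl fun t _ => ?_⟩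
  have : ∑ u ∈ Finset.range (t + 1), a u ω ^ 2 ≤ N :=
    (hs.sum_le_tsum _ fun _ _ => sq_nonneg _).trans hN
  simp [hb, this]

end Noise

/-! ### The optimality operator -/

noncomputable section

variable {S A : Type*} {n τ₀ : ℕ}

/-- The value that the table `q` assigns to the next state `s'` when one time step of `m` has been
executed: the value of the rest of `m`, or the best value in `s'` if `m` has ended. -/
def nextValue (q : S → IntAction A n τ₀ → ℝ) (m : IntAction A n τ₀) (s' : S) : ℝ :=
  match rest m with
  | none => ⨆ m', q s' m'
  | some m' => q s' m'

theorem tdTarget_eq (γ : ℝ) (q : S → IntAction A n τ₀ → ℝ) (m : IntAction A n τ₀) (r : ℝ)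
    (s' : S) : tdTarget γ q m r s' = r + γ * nextValue q m s' := rfl

section Lipschitz

variable [Fintype A]

theorem nextValue_le_add {q q' : S → IntAction A n τ₀ → ℝ} {K : ℝ}
    (h : ∀ s m, q s m ≤ q' s m + K) (m : IntAction A n τ₀) (s' : S) :
    nextValue q m s' ≤ nextValue q' m s' + K := by
  have : Nonempty (IntAction A n τ₀) := ⟨m⟩
  unfold nextValue
  split
  · exact ciSup_le fun m' => (h s' m').trans
      (by gcongr; exact le_ciSup (f := q' s') (Set.finite_range _).bddAbove m')
  · exact h s' _

/-- The one-step lookahead is nonexpansive in the sup norm for each realization of the next state,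
not only in the mean. -/
theorem abs_nextValue_sub_le {q q' : S → IntAction A n τ₀ → ℝ} {K : ℝ}
    (h : ∀ s m, |q s m - q' s m| ≤ K) (m : IntAction A n τ₀) (s' : S) :
    |nextValue q m s' - nextValue q' m s'| ≤ K := by
  rw [abs_sub_le_iff]
  have h1 : nextValue q m s' ≤ nextValue q' m s' + K :=
    nextValue_le_add (fun s m => by linarith [(abs_sub_le_iff.1 (h s m)).1]) m s'
  have h2 : nextValue q' m s' ≤ nextValue q m s' + K :=
    nextValue_le_add (fun s m => by linarith [(abs_sub_le_iff.1 (h s m)).2]) m s'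
  constructor <;> linarith

end Lipschitz

variable [MeasurableSpace S] (M : MDP S A)

theorem MDP.trans_nonneg (s : S) (a : A) (s' : S) : 0 ≤ M.trans s a s' := measureReal_nonneg

theorem memLp_reward {s : S} {a : A}
    (hvar : evariance (fun x : ℝ × S => x.1) (M.step s a) < ⊤) :
    MemLp (fun x : ℝ × S => x.1) 2 (M.step s a) := by
  have := M.isProb s a
  exact (evariance_lt_top_iff_memLp measurable_fst.aestronglyMeasurable).1 hvar

variable [Fintype S] (expert : Fin n → S → A) (c γ : ℝ)

/-- The optimality operator of the decision process on tables of action values. -/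
def bellman (q : S → IntAction A n τ₀ → ℝ) (s : S) (m : IntAction A n τ₀) : ℝ :=
  stepReward M expert c s m + γ * ∑ s', M.trans s (lower expert m s) s' * nextValue q m s'

/-! ### The expectation operator of a policy -/

section Policy

variable [Fintype A] (π : Policy S A n τ₀)

theorem expectNext_mono {f g : S → IntAction A n τ₀ → ℝ} (h : f ≤ g) :
    expectNext M expert π f ≤ expectNext M expert π g := by
  intro s m
  refine Finset.sum_le_sum fun s' _ => mul_le_mul_of_nonneg_left ?_ (M.trans_nonneg _ _ _)
  split
  · exact Finset.sum_le_sum fun m' _ => mul_le_mul_of_nonneg_left (h s' m') ((π s').2.1 m')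
  · exact h s' _

theorem expectNext_sub_smul (f g : S → IntAction A n τ₀ → ℝ) (b : ℝ) :
    expectNext M expert π (f - b • g) = expectNext M expert π f - b • expectNext M expert π g := by
  funext s m
  simp only [expectNext, Pi.sub_apply, Pi.smul_apply, smul_eq_mul, Finset.mul_sum]
  rw [← Finset.sum_sub_distrib]
  refine Finset.sum_congr rfl fun s' _ => ?_
  split
  · simp only [Finset.mul_sum]
    rw [← Finset.sum_sub_distrib]
    exact Finset.sum_congr rfl fun m' _ => by ring
  · ring

theorem iterate_expectNext_sub_smul (f g : S → IntAction A n τ₀ → ℝ) (b : ℝ) (k : ℕ) :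
    (expectNext M expert π)^[k] (f - b • g) =
      (expectNext M expert π)^[k] f - b • (expectNext M expert π)^[k] g := by
  induction k with
  | zero => rfl
  | succ k ih => simp only [Function.iterate_succ_apply', ih, expectNext_sub_smul]

theorem expectNext_le_nextValue (q : S → IntAction A n τ₀ → ℝ) (s : S) (m : IntAction A n τ₀) :
    expectNext M expert π q s m ≤ ∑ s', M.trans s (lower expert m s) s' * nextValue q m s' := by
  refine Finset.sum_le_sum fun s' _ => mul_le_mul_of_nonneg_left ?_ (M.trans_nonneg _ _ _)
  unfold nextValue
  cases rest m
  · calc ∑ m', (π s').1 m' * q s' m' ≤ ∑ m', (π s').1 m' * ⨆ m'', q s' m'' :=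
          Finset.sum_le_sum fun m' _ => mul_le_mul_of_nonneg_left
            (le_ciSup (f := q s') (Set.finite_range _).bddAbove m') ((π s').2.1 m')
      _ = ⨆ m'', q s' m'' := by rw [← Finset.sum_mul, (π s').2.2, one_mul]
  · exact le_rfl

theorem exists_greedy_policy [Nonempty (IntAction A n τ₀)] (q : S → IntAction A n τ₀ → ℝ) :
    ∃ π : Policy S A n τ₀, ∀ s m, expectNext M expert π q s m =
      ∑ s', M.trans s (lower expert m s) s' * nextValue q m s' := by
  classical
  choose b hb using fun s' => exists_eq_ciSup_of_finite (f := q s')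
  refine ⟨fun s' => ⟨Pi.single (b s') 1, single_mem_stdSimplex ℝ (b s')⟩, fun s m => ?_⟩
  refine Finset.sum_congr rfl fun s' _ => ?_
  unfold nextValue
  congr 1
  cases rest m
  · simp only
    rw [← hb s']
    simp [Pi.single_apply]
  · rfl

end Policy

variable [DiscreteMeasurableSpace S]

/-- The mean of a function of the next state is its average over the transition probabilities;
no joint law with the reward is involved. -/
theorem MDP.integral_snd (s : S) (a : A) (f : S → ℝ) :
    ∫ x, f x.2 ∂(M.step s a) = ∑ s', M.trans s a s' * f s' := by
  have := M.isProb s a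
  have : IsProbabilityMeasure ((M.step s a).map Prod.snd) :=
    Measure.isProbabilityMeasure_map measurable_snd.aemeasurable
  rw [← integral_map (f := f) measurable_snd.aemeasurable
    (measurable_of_countable f).aestronglyMeasurable, integral_fintype (Integrable.of_finite)]
  refine Finset.sum_congr rfl fun s' _ => ?_
  rw [smul_eq_mul, MDP.trans, map_measureReal_apply measurable_snd (measurableSet_singleton s')]

theorem MDP.sum_trans (s : S) (a : A) : ∑ s', M.trans s a s' = 1 := by
  have := M.isProb s a
  simpa using (M.integral_snd s a fun _ => 1).symm

/-! ### The noise of an observation -/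

/-- The error of the temporal-difference target that a single observation `x` would give if the
table were already `q`. -/
def targetNoise (q : S → IntAction A n τ₀ → ℝ) (s : S) (m : IntAction A n τ₀) (x : ℝ × S) : ℝ :=
  tdTarget γ q m (x.1 + c * ((duration m : ℝ) - 1)) x.2 - q s m

theorem measurable_targetNoise (q : S → IntAction A n τ₀ → ℝ) (s : S) (m : IntAction A n τ₀) :
    Measurable (targetNoise c γ q s m) := by
  have h : Measurable fun x : ℝ × S => nextValue q m x.2 :=
    (measurable_of_countable (nextValue q m)).comp measurable_snd
  exact ((measurable_fst.add_const _).add (h.const_mul γ)).sub_const _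

theorem memLp_nextValue (q : S → IntAction A n τ₀ → ℝ) (s : S) (a : A) (m : IntAction A n τ₀) :
    MemLp (fun x : ℝ × S => nextValue q m x.2) 2 (M.step s a) := by
  have := M.isProb s a
  refine MemLp.of_bound ((measurable_of_countable (nextValue q m)).comp
    measurable_snd).aestronglyMeasurable ‖nextValue q m‖ (Eventually.of_forall fun x => ?_)
  exact norm_le_pi_norm (nextValue q m) x.2

theorem memLp_targetNoise (q : S → IntAction A n τ₀ → ℝ) (s : S) (m : IntAction A n τ₀) {a : A}
    (hvar : evariance (fun x : ℝ × S => x.1) (M.step s a) < ⊤) :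
    MemLp (targetNoise c γ q s m) 2 (M.step s a) := by
  have := M.isProb s a
  exact (((memLp_reward M hvar).add (memLp_const _)).add
    ((memLp_nextValue M q s a m).const_mul γ)).sub (memLp_const _)

/-- At a fixed point of the optimality operator the noise of an observation is centred. -/
theorem integral_targetNoise {q : S → IntAction A n τ₀ → ℝ}
    (hq : ∀ s m, q s m = bellman M expert c γ q s m) (s : S) (m : IntAction A n τ₀)
    (hvar : evariance (fun x : ℝ × S => x.1) (M.step s (lower expert m s)) < ⊤) :
    ∫ x, targetNoise c γ q s m x ∂(M.step s (lower expert m s)) = 0 := by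
  have := M.isProb s (lower expert m s)
  have h1 : Integrable (fun x : ℝ × S => x.1) (M.step s (lower expert m s)) :=
    (memLp_reward M hvar).integrable one_le_two
  have h2 : Integrable (fun x : ℝ × S => γ * nextValue q m x.2) (M.step s (lower expert m s)) :=
    ((memLp_nextValue M q s _ m).integrable one_le_two).const_mul γ
  have h3 : Integrable (fun x : ℝ × S => x.1 + c * ((duration m : ℝ) - 1))
    (M.step s (lower expert m s)) := h1.add (integrable_const _)
  have h4 : Integrable (fun x : ℝ × S => x.1 + c * ((duration m : ℝ) - 1) +
    γ * nextValue q m x.2) (M.step s (lower expert m s)) := h3.add h2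
  have h5 := hq s m
  simp only [bellman, stepReward, MDP.meanReward] at h5
  simp only [targetNoise, tdTarget_eq]
  rw [integral_sub h4 (integrable_const _), integral_add h3 h2, integral_add h1
    (integrable_const _), integral_const_mul γ, M.integral_snd s _ (nextValue q m)]
  simp only [integral_const, probReal_univ, one_smul]
  linarith

/-! ### Values of policies and the Bellman equation -/

variable [Fintype A] (π : Policy S A n τ₀)

theorem exists_bellman_fixedPoint (hγ0 : 0 ≤ γ) (hγ1 : γ < 1) :
    ∃ q : S → IntAction A n τ₀ → ℝ, ∀ s m, q s m = bellman M expert c γ q s m := by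
  have hc : ContractingWith ⟨γ, hγ0⟩ (bellman (n := n) (τ₀ := τ₀) M expert c γ) := by
    refine ⟨by exact_mod_cast hγ1, LipschitzWith.of_dist_le_mul fun q q' => ?_⟩
    have hK : 0 ≤ dist q q' := dist_nonneg
    refine (dist_pi_le_iff (by positivity)).2 fun s => (dist_pi_le_iff (by positivity)).2
      fun m => ?_
    have hd : ∀ s m, |q s m - q' s m| ≤ dist q q' := fun s m =>
      (dist_le_pi_dist (q s) (q' s) m).trans (dist_le_pi_dist q q' s)
    rw [Real.dist_eq, bellman, bellman, add_sub_add_left_eq_sub, ← mul_sub,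
      ← Finset.sum_sub_distrib, abs_mul, abs_of_nonneg hγ0]
    refine mul_le_mul_of_nonneg_left ?_ hγ0
    calc |∑ s', (M.trans s (lower expert m s) s' * nextValue q m s' -
          M.trans s (lower expert m s) s' * nextValue q' m s')|
        ≤ ∑ s', M.trans s (lower expert m s) s' * dist q q' := by
          refine (Finset.abs_sum_le_sum_abs _ _).trans (Finset.sum_le_sum fun s' _ => ?_)
          rw [← mul_sub, abs_mul, abs_of_nonneg (M.trans_nonneg _ _ _)]
          exact mul_le_mul_of_nonneg_left (abs_nextValue_sub_le hd m s') (M.trans_nonneg _ _ _)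
      _ = dist q q' := by rw [← Finset.sum_mul, M.sum_trans, one_mul]
  exact ⟨hc.fixedPoint, fun s m => (congrFun (congrFun hc.fixedPoint_isFixedPt s) m).symm⟩

theorem expectNext_const (b : ℝ) :
    expectNext M expert π (fun _ _ => b) = fun _ _ => b := by
  funext s m
  have hπ : ∀ s', ∑ m', (π s').1 m' * b = b := fun s' => by
    rw [← Finset.sum_mul, (π s').2.2, one_mul]
  unfold expectNext
  cases rest m <;> simp only [hπ] <;> rw [← Finset.sum_mul, M.sum_trans, one_mul]

theorem abs_iterate_expectNext_le (f : S → IntAction A n τ₀ → ℝ) (k : ℕ) (s : S)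
    (m : IntAction A n τ₀) : |(expectNext M expert π)^[k] f s m| ≤ ‖f‖ := by
  have hmono : Monotone ((expectNext M expert π)^[k]) :=
    Monotone.iterate (fun _ _ h => expectNext_mono M expert π h) k
  have hconst : ∀ b : ℝ, (expectNext M expert π)^[k] (fun _ _ => b) = fun _ _ => b :=
    fun b => Function.iterate_fixed (expectNext_const M expert π b) k
  have hf : ∀ s m, |f s m| ≤ ‖f‖ := fun s m =>
    (norm_le_pi_norm (f s) m).trans (norm_le_pi_norm f s)
  have h1 := hmono (show (fun _ _ => -‖f‖) ≤ f from fun s m => (abs_le.1 (hf s m)).1) s m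
  have h2 := hmono (show f ≤ fun _ _ => ‖f‖ from fun s m => (abs_le.1 (hf s m)).2) s m
  rw [hconst] at h1 h2
  exact abs_le.2 ⟨h1, h2⟩

theorem summable_discounted (hγ0 : 0 ≤ γ) (hγ1 : γ < 1) (f : S → IntAction A n τ₀ → ℝ) (s : S)
    (m : IntAction A n τ₀) :
    Summable fun k : ℕ => γ ^ k * (expectNext M expert π)^[k] f s m := by
  refine Summable.of_norm_bounded ((summable_geometric_of_lt_one hγ0 hγ1).mul_right ‖f‖)
    fun k => ?_
  rw [norm_mul, Real.norm_of_nonneg (pow_nonneg hγ0 k)]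
  exact mul_le_mul_of_nonneg_left (abs_iterate_expectNext_le M expert π f k s m)
    (pow_nonneg hγ0 k)

/-- The discounted sum of the one-step rewards `q - γ • expectNext q`, for which `q` would be the
value of `π`, telescopes to `q`. -/
theorem tsum_discounted_sub (hγ0 : 0 ≤ γ) (hγ1 : γ < 1) (q : S → IntAction A n τ₀ → ℝ) (s : S)
    (m : IntAction A n τ₀) :
    ∑' k : ℕ, γ ^ k * (expectNext M expert π)^[k] (q - γ • expectNext M expert π q) s m =
      q s m := by
  set u : ℕ → ℝ := fun k => γ ^ k * (expectNext M expert π)^[k] q s m with hu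
  have hsum : Summable u := summable_discounted M expert γ π hγ0 hγ1 q s m
  have hterm : ∀ k, γ ^ k * (expectNext M expert π)^[k] (q - γ • expectNext M expert π q) s m =
      u k - u (k + 1) := by
    intro k
    rw [iterate_expectNext_sub_smul, ← Function.iterate_succ_apply]
    simp only [hu, Pi.sub_apply, Pi.smul_apply, smul_eq_mul]
    ring
  simp only [hterm]
  rw [hsum.tsum_sub ((summable_nat_add_iff 1).2 hsum), hsum.tsum_eq_zero_add]
  simp [hu]

theorem policyValue_le (hγ0 : 0 ≤ γ) (hγ1 : γ < 1) {q : S → IntAction A n τ₀ → ℝ}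
    (hq : ∀ s m, stepReward M expert c s m + γ * expectNext M expert π q s m ≤ q s m) (s : S)
    (m : IntAction A n τ₀) : policyValue M expert c γ π s m ≤ q s m := by
  rw [← tsum_discounted_sub M expert γ π hγ0 hγ1 q s m, policyValue]
  refine (summable_discounted M expert γ π hγ0 hγ1 _ s m).tsum_le_tsum (fun k => ?_)
    (summable_discounted M expert γ π hγ0 hγ1 _ s m)
  have hmono : Monotone ((expectNext M expert π)^[k]) :=
    Monotone.iterate (fun _ _ h => expectNext_mono M expert π h) k
  refine mul_le_mul_of_nonneg_left (hmono (fun s m => ?_) s m) (pow_nonneg hγ0 k)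
  simpa [le_sub_iff_add_le] using hq s m

theorem policyValue_eq (hγ0 : 0 ≤ γ) (hγ1 : γ < 1) {q : S → IntAction A n τ₀ → ℝ}
    (hq : ∀ s m, q s m = stepReward M expert c s m + γ * expectNext M expert π q s m) (s : S)
    (m : IntAction A n τ₀) : policyValue M expert c γ π s m = q s m := by
  have hr : stepReward M expert c = q - γ • expectNext M expert π q := by
    funext s m
    simp [hq s m]
  rw [policyValue, hr, tsum_discounted_sub M expert γ π hγ0 hγ1 q s m]

/-- A fixed point of the optimality operator dominates the values of all policies, and the policy
that is greedy for it attains it, so it is the optimal action value. -/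
theorem isGreatest_policyValue (hγ0 : 0 ≤ γ) (hγ1 : γ < 1) {q : S → IntAction A n τ₀ → ℝ}
    (hq : ∀ s m, q s m = bellman M expert c γ q s m) (s : S) (m : IntAction A n τ₀) :
    IsGreatest (Set.range fun π : Policy S A n τ₀ => policyValue M expert c γ π s m) (q s m) := by
  have : Nonempty (IntAction A n τ₀) := ⟨m⟩
  constructor
  · obtain ⟨π, hπ⟩ := exists_greedy_policy M expert q
    refine ⟨π, policyValue_eq M expert c γ π hγ0 hγ1 (fun s m => ?_) s m⟩
    rw [hπ]
    exact hq s m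
  · rintro _ ⟨π, rfl⟩
    refine policyValue_le M expert c γ π hγ0 hγ1 (fun s m => ?_) s m
    rw [hq s m, bellman]
    gcongr
    exact expectNext_le_nextValue M expert π q s m

end

/-! ### Convergence of the learning rule -/

/-- The pathwise part of the argument: where the accumulated noise converges, the tables of a run
converge to `q`. The deviation `Q - q`, corrected by the noise still to come, is averaged towards
values that are contracted by `γ` up to a vanishing error. -/
theorem IsRun.tendsto_of_tendsto_noise {S A : Type*} [Fintype S] [Fintype A]
    [MeasurableSpace S] {n τ₀ : ℕ} {M : MDP S A} {expert : Fin n → S → A} {c γ : ℝ}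
    {Ω : Type*} [mΩ : MeasurableSpace Ω] {μ : Measure Ω} {ℱ : Filtration ℕ mΩ}
    {α : ℕ → S → IntAction A n τ₀ → Ω → ℝ} {X : ℕ → S → IntAction A n τ₀ → Ω → ℝ × S}
    {Q : ℕ → S → IntAction A n τ₀ → Ω → ℝ} (hrun : IsRun M expert c γ μ ℱ α X Q)
    (hγ0 : 0 ≤ γ) (hγ1 : γ < 1) {q : S → IntAction A n τ₀ → ℝ} {ω : Ω}
    (hsum : ∀ s m, Tendsto (fun T => ∑ t ∈ Finset.range T, α t s m ω) atTop atTop)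
    (hsq : ∀ s m, Summable fun t => α t s m ω ^ 2)
    (hnoise : ∀ s m, ∃ l, Tendsto (fun T => ∑ t ∈ Finset.range T,
      α t s m ω * targetNoise c γ q s m (X t s m ω)) atTop (𝓝 l)) (s : S)
    (m : IntAction A n τ₀) : Tendsto (fun t => Q t s m ω) atTop (𝓝 (q s m)) := by
  choose l hl using hnoise
  -- `W T` is minus the noise that is still to come after time `T`
  set W : ℕ → S × IntAction A n τ₀ → ℝ := fun T x => ∑ t ∈ Finset.range T,
    α t x.1 x.2 ω * targetNoise c γ q x.1 x.2 (X t x.1 x.2 ω) - l x.1 x.2 with hW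
  have hW0 : Tendsto W atTop (𝓝 0) :=
    tendsto_pi_nhds.2 fun x => by simpa using (hl x.1 x.2).sub_const (l x.1 x.2)
  set D : ℕ → S × IntAction A n τ₀ → ℝ := fun t x => Q t x.1 x.2 ω - q x.1 x.2 - W t x with hD
  have hdist : ∀ t s m, |Q t s m ω - q s m| ≤ ‖D t‖ + ‖W t‖ := by
    intro t s m
    have h1 := norm_le_pi_norm (D t + W t) (s, m)
    have h2 : (D t + W t) (s, m) = Q t s m ω - q s m := by simp [hD]
    rw [h2] at h1
    exact h1.trans (norm_add_le _ _)
  have hD0 : Tendsto D atTop (𝓝 0) := by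
    refine tendsto_zero_of_contracting_averaging (a := fun t x => α t x.1 x.2 ω)
      (e := fun t x => γ * (nextValue (fun s m => Q t s m ω) x.2 (X t x.1 x.2 ω).2 -
        nextValue q x.2 (X t x.1 x.2 ω).2) - W t x)
      (ε := fun t => (γ + 1) * ‖W t‖) hγ0 hγ1 (fun t x => hrun.rate_nonneg t x.1 x.2 ω)
      (fun x => ?_) (fun x => hsum x.1 x.2) (fun t x => ?_) (fun t x => ?_) ?_
    · filter_upwards [(hsq x.1 x.2).tendsto_atTop_zero.eventually (ge_mem_nhds one_pos)] with t ht
      exact (abs_le_one_iff_mul_self_le_one.2 (by rwa [← sq])).trans' (le_abs_self _)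
    · simp only [hD, hW, Finset.sum_range_succ, hrun.update, targetNoise, tdTarget_eq]
      ring
    · have h1 : |nextValue (fun s m => Q t s m ω) x.2 (X t x.1 x.2 ω).2 -
          nextValue q x.2 (X t x.1 x.2 ω).2| ≤ ‖D t‖ + ‖W t‖ :=
        abs_nextValue_sub_le (hdist t) _ _
      have h2 : |W t x| ≤ ‖W t‖ := norm_le_pi_norm (W t) x
      refine (abs_sub _ _).trans ?_
      rw [abs_mul, abs_of_nonneg hγ0]
      have := mul_le_mul_of_nonneg_left h1 hγ0
      linarith
    · simpa using (tendsto_zero_iff_norm_tendsto_zero.1 hW0).const_mul (γ + 1)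
  have h := ((tendsto_pi_nhds.1 (hD0.add hW0)) (s, m)).add_const (q s m)
  simpa [hD] using h

end EASpace

theorem mainTheorem1 {S A : Type*} [Fintype S] [Fintype A]
    [MeasurableSpace S] [DiscreteMeasurableSpace S] {n τ₀ : ℕ}
    (M : EASpace.MDP S A) (expert : Fin n → S → A) (c γ : ℝ) (hγ : γ ∈ Set.Ioo (0 : ℝ) 1)
    (C : ℝ≥0) (hvar : ∀ s a, evariance (fun x : ℝ × S => x.1) (M.step s a) ≤ C)
    {Ω : Type*} [mΩ : MeasurableSpace Ω] (μ : Measure Ω) [IsProbabilityMeasure μ]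
    (ℱ : Filtration ℕ mΩ)
    (α : ℕ → S → EASpace.IntAction A n τ₀ → Ω → ℝ)
    (X : ℕ → S → EASpace.IntAction A n τ₀ → Ω → ℝ × S)
    (Q : ℕ → S → EASpace.IntAction A n τ₀ → Ω → ℝ)
    (hrun : EASpace.IsRun M expert c γ μ ℱ α X Q)
    (hsum : ∀ᵐ ω ∂μ, ∀ s m,
      Tendsto (fun T => ∑ t ∈ Finset.range T, α t s m ω) atTop atTop)
    (hsq : ∀ᵐ ω ∂μ, ∀ s m, Summable (fun t => α t s m ω ^ 2)) :
    (∀ s (m : EASpace.IntAction A n τ₀),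
      IsGreatest (Set.range fun π : EASpace.Policy S A n τ₀ =>
        EASpace.policyValue M expert c γ π s m) (EASpace.optimalValue M expert c γ s m)) ∧
    ∀ᵐ ω ∂μ, ∀ s m, Tendsto (fun t => Q t s m ω) atTop
      (𝓝 (EASpace.optimalValue M expert c γ s m)) := by
  obtain ⟨q, hq⟩ := EASpace.exists_bellman_fixedPoint (n := n) (τ₀ := τ₀) M expert c γ
    hγ.1.le hγ.2
  have hgreat := EASpace.isGreatest_policyValue M expert c γ hγ.1.le hγ.2 hq
  have hopt : ∀ s m, EASpace.optimalValue M expert c γ s m = q s m :=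
    fun s m => (hgreat s m).csSup_eq
  have hvar' : ∀ s a, evariance (fun x : ℝ × S => x.1) (M.step s a) < ⊤ :=
    fun s a => (hvar s a).trans_lt ENNReal.coe_lt_top
  have hnoise : ∀ᵐ ω ∂μ, ∀ s m, ∃ l, Tendsto (fun T => ∑ t ∈ Finset.range T,
      α t s m ω * EASpace.targetNoise c γ q s m (X t s m ω)) atTop (𝓝 l) := by
    refine ae_all_iff.2 fun s => ae_all_iff.2 fun m => ?_
    have := M.isProb s (EASpace.lower expert m s)
    exact EASpace.ae_exists_tendsto_weighted_noise
      (fun t => hrun.rate_meas t s m) (fun t => hrun.obs_meas t s m)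
      (fun t => hrun.obs_law t s m) (EASpace.measurable_targetNoise c γ q s m)
      (EASpace.memLp_targetNoise M c γ q s m (hvar' _ _))
      (EASpace.integral_targetNoise M expert c γ hq s m (hvar' _ _))
      (hsq.mono fun ω h => h s m)
  simp only [hopt]
  refine ⟨hgreat, ?_⟩
  filter_upwards [hsum, hsq, hnoise] with ω h1 h2 h3 s m
  exact hrun.tendsto_of_tendsto_noise hγ.1.le hγ.2 h1 h2 h3 s m
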